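/- For $n\times n$ complex matrices $A_1,\dots,A_k$ let $Q(X)=\sum_{i=1}^k A_iXA_i^*$ and let $Q'(X)=\sum_{i=1}^k A_i^*XA_i$ be its dual with respect to $\langle X,Y\rangle=\operatorname{tr}(XY^*)$. The operator $Q$ is called a quantum channel if $\sum_i A_i^*A_i=I_n$, and it is called positive if $Q(X)$ is positive definite for every positive semidefinite $X$ with $\operatorname{tr}X=1$. Let $Q$ be a positive quantum channel on $\mathbb C^{n\times n}$, and let $\rho_0,\rho_T\in\mathbb C^{n\times n}$ be positive definite matrices of trace $1$. Consider the system $$Q(\phi_T)=\phi_0,\quad Q'(\hat\phi_0)=\hat\phi_T,\quad \rho_0=\chi_0\hat\phi_0\chi_0^*,\quad \rho_T=\chi_T\hat\phi_T\chi_T^*,\quad \phi_0=\chi_0^*\chi_0,\quad \phi_T=\chi_T^*\chi_T \qquad (\ast)$$ with positive definite unknowns $\phi_0,\phi_T,\hat\phi_0,\hat\phi_T\in\mathbb C^{n\times n}$ and arbitrary (not necessarily Hermitian) unknowns $\chi_0,\chi_T\in\mathbb C^{n\times n}$. 1. There exist positive definite $\phi_0,\phi_T,\hat\phi_0,\hat\phi_T$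 and matrices $\chi_0,\chi_T$ satisfying $(\ast)$. 2. Conversely, every solution of $(\ast)$ yields a scaling of $Q$ to a quantum channel $R$ with $R(\rho_T)=\rho_0$: the matrices $\chi_0,\chi_T$ are invertible and, for the invertible matrices $S=\rho_0^{1/2}(\chi_0^*)^{-1}$ and $T=\chi_T^*\rho_T^{-1/2}$, the operator $R(X)=S\,Q(TXT^*)\,S^*$ is a quantum channel satisfying $R(\rho_T)=\rho_0$. -/

import Mathlib

open scoped Matrix ComplexOrder MatrixOrder

noncomputable section

namespace QuantumBridge

/-- The completely positive operator `X ↦ ∑ i, Aᵢ X Aᵢ*` on complex `n × n` matrices. -/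
def krausMap {n k : ℕ} (A : Fin k → Matrix (Fin n) (Fin n) ℂ) :
    Matrix (Fin n) (Fin n) ℂ →ₗ[ℂ] Matrix (Fin n) (Fin n) ℂ where
  toFun X := ∑ i, A i * X * (A i)ᴴ
  map_add' X Y := by
    simp only [mul_add, add_mul, Finset.sum_add_distrib]
  map_smul' c X := by
    simp only [mul_smul_comm, smul_mul_assoc, Finset.smul_sum, RingHom.id_apply]

/-- The dual operator `X ↦ ∑ i, Aᵢ* X Aᵢ`. -/
def krausDual {n k : ℕ} (A : Fin k → Matrix (Fin n) (Fin n) ℂ) :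
    Matrix (Fin n) (Fin n) ℂ →ₗ[ℂ] Matrix (Fin n) (Fin n) ℂ where
  toFun X := ∑ i, (A i)ᴴ * X * A i
  map_add' X Y := by
    simp only [mul_add, add_mul, Finset.sum_add_distrib]
  map_smul' c X := by
    simp only [mul_smul_comm, smul_mul_assoc, Finset.smul_sum, RingHom.id_apply]

/-- `krausDual A` is the adjoint of `krausMap A` for the inner product `⟨X, Y⟩ = tr (X Y*)`;
so it depends on the operator `krausMap A` only, not on the chosen family `A`. -/
theorem trace_krausMap_mul {n k : ℕ} (A : Fin k → Matrix (Fin n) (Fin n) ℂ)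
    (X Y : Matrix (Fin n) (Fin n) ℂ) :
    (krausMap A X * Yᴴ).trace = (X * (krausDual A Y)ᴴ).trace := by
  simp only [krausMap, krausDual, LinearMap.coe_mk, AddHom.coe_mk, Finset.sum_mul,
    Matrix.conjTranspose_sum, Finset.mul_sum, Matrix.trace_sum, Matrix.conjTranspose_mul,
    Matrix.conjTranspose_conjTranspose]
  refine Finset.sum_congr rfl fun i _ => ?_
  rw [Matrix.mul_assoc, Matrix.mul_assoc, Matrix.trace_mul_comm]
  simp only [Matrix.mul_assoc]

/-- A quantum channel: a completely positive operator `X ↦ ∑ i, Aᵢ X Aᵢ*` with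
`∑ i, Aᵢ* Aᵢ = I`. -/
def IsQuantumChannel {n : ℕ}
    (Q : Matrix (Fin n) (Fin n) ℂ →ₗ[ℂ] Matrix (Fin n) (Fin n) ℂ) : Prop :=
  ∃ (k : ℕ) (A : Fin k → Matrix (Fin n) (Fin n) ℂ),
    Q = krausMap A ∧ ∑ i, (A i)ᴴ * A i = 1

/-- `Q` is positive: it maps every density matrix (positive semidefinite of trace one)
to a positive definite matrix. -/
def IsPositive {n : ℕ}
    (Q : Matrix (Fin n) (Fin n) ℂ →ₗ[ℂ] Matrix (Fin n) (Fin n) ℂ) : Prop :=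
  ∀ X : Matrix (Fin n) (Fin n) ℂ, X.PosSemidef → X.trace = 1 → (Q X).PosDef

/-- The scaling `X ↦ S Q(T X T*) S*` of `Q` by invertible matrices `S` and `T`. -/
def scaling {n : ℕ} (Q : Matrix (Fin n) (Fin n) ℂ →ₗ[ℂ] Matrix (Fin n) (Fin n) ℂ)
    (S T : GL (Fin n) ℂ) : Matrix (Fin n) (Fin n) ℂ →ₗ[ℂ] Matrix (Fin n) (Fin n) ℂ where
  toFun X := S.1 * Q (T.1 * X * T.1ᴴ) * S.1ᴴ
  map_add' X Y := by
    simp only [mul_add, add_mul, map_add]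
  map_smul' c X := by
    simp only [mul_smul_comm, smul_mul_assoc, map_smul, RingHom.id_apply]

/-- The Georgiou–Pavon equations for the operator `Q = krausMap A`, its dual `Q' = krausDual A`
and the matrices `ρ₀`, `ρT`, in the positive definite unknowns `φ₀, φT, φh₀, φhT` and the
arbitrary (not necessarily Hermitian) unknowns `χ₀, χT`. -/
structure GeorgiouPavon {n k : ℕ} (A : Fin k → Matrix (Fin n) (Fin n) ℂ)
    (ρ₀ ρT φ₀ φT φh₀ φhT χ₀ χT : Matrix (Fin n) (Fin n) ℂ) : Prop where
  posDef_φ₀ : φ₀.PosDef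
  posDef_φT : φT.PosDef
  posDef_φh₀ : φh₀.PosDef
  posDef_φhT : φhT.PosDef
  map_φT : krausMap A φT = φ₀
  dual_φh₀ : krausDual A φh₀ = φhT
  ρ₀_eq : ρ₀ = χ₀ * φh₀ * χ₀ᴴ
  ρT_eq : ρT = χT * φhT * χTᴴ
  φ₀_eq : φ₀ = χ₀ᴴ * χ₀
  φT_eq : φT = χTᴴ * χT

end QuantumBridge

end

/-!
Diagonalizing `ρ₀` and `ρT`, it suffices to find `S`, `U` with `S Q(U* U) S*` and `U Q'(S* S) U*`
equal to given positive diagonal matrices of equal trace. Over nonzero upper triangular `S` and `U`,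
consider the product of the geometric means of the moduli of the diagonal entries of `S` and of `U`,
weighted by the prescribed diagonals, against the energy `tr (S Q(U* U) S*) = tr (U Q'(S* S) U*)`.
Positivity of `Q` keeps the energy nonzero, so by homogeneity the ratio of the squared product to
the energy attains its maximum. At a maximizer, replacing `S` by `B S` with `B = 1 + z E_ij` and
`i < j` cannot lower the energy, so the off-diagonal entries of `S Q(U* U) S*` vanish; positive
diagonal `B` lead to the equality case of the inequality between the arithmetic and geometric means,
which identifies the diagonal with the weights up to a factor. The same holds for `U`, with the same
factor since both matrices have the energy as their trace.

Then `φT = U* U`, `φh₀ = S* S`, `χT = U` and `χ₀ = √ρ₀ (S*)⁻¹` solve the system. Conversely, for a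
solution, `√ρ (χ*)⁻¹` is a congruence carrying `χ* χ` to `ρ = χ φh χ*` whose Gram matrix is `φh`; so
with `S` and `T⁻¹` of this form, `R(ρT) = ρ₀` is `Q(φT) = φ₀` and `R'(1) = 1` is `Q'(φh₀) = φhT`.
-/

namespace QuantumBridge

open Matrix

section HomogeneousMaximum

variable {E F α : Type*} [NormedAddCommGroup E] [NormedSpace ℝ E] [ProperSpace E] [Nontrivial E]
  [NormedAddCommGroup F] [NormedSpace ℝ F] [ProperSpace F] [Nontrivial F]
  [LinearOrder α] [TopologicalSpace α] [ClosedIciTopology α]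

theorem exists_isMaxOn_of_smul_invariant {h : E × F → α}
    (hcont : ContinuousOn h ({0}ᶜ ×ˢ {0}ᶜ))
    (hinv : ∀ a b : ℝ, 0 < a → 0 < b → ∀ x y, h (a • x, b • y) = h (x, y)) :
    ∃ p ∈ ({0}ᶜ ×ˢ {0}ᶜ : Set (E × F)), IsMaxOn h ({0}ᶜ ×ˢ {0}ᶜ) p := by
  have hsub : Metric.sphere (0 : E) 1 ×ˢ Metric.sphere (0 : F) 1 ⊆ {0}ᶜ ×ˢ {0}ᶜ :=
    Set.prod_mono (fun x hx => ne_zero_of_mem_unit_sphere ⟨x, hx⟩)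
      fun y hy => ne_zero_of_mem_unit_sphere ⟨y, hy⟩
  obtain ⟨p, hp, hmax⟩ :=
    ((isCompact_sphere (0 : E) 1).prod (isCompact_sphere (0 : F) 1)).exists_isMaxOn
      ((NormedSpace.sphere_nonempty.mpr zero_le_one).prod
        (NormedSpace.sphere_nonempty.mpr zero_le_one)) (hcont.mono hsub)
  refine ⟨p, hsub hp, fun q hq => ?_⟩
  have hq₁ : q.1 ≠ 0 := hq.1
  have hq₂ : q.2 ≠ 0 := hq.2
  have hle : h (‖q.1‖⁻¹ • q.1, ‖q.2‖⁻¹ • q.2) ≤ h p :=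
    hmax ⟨by simp [norm_smul, hq₁], by simp [norm_smul, hq₂]⟩
  rwa [hinv _ _ (by positivity) (by positivity)] at hle

open scoped Matrix.Norms.Elementwise in
theorem exists_isUpperTriangular_forall_le_of_smul_invariant {ι 𝕜 : Type*} [Finite ι]
    [LinearOrder ι] [Nonempty ι] [RCLike 𝕜] {f : Matrix ι ι 𝕜 → Matrix ι ι 𝕜 → α}
    (hcont : ContinuousOn (fun p : Matrix ι ι 𝕜 × Matrix ι ι 𝕜 => f p.1 p.2) ({0}ᶜ ×ˢ {0}ᶜ))
    (hinv : ∀ a b : ℝ, 0 < a → 0 < b → ∀ S U, f (a • S) (b • U) = f S U) :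
    ∃ S U : Matrix ι ι 𝕜, S.IsUpperTriangular ∧ U.IsUpperTriangular ∧ S ≠ 0 ∧ U ≠ 0 ∧
      ∀ S' U' : Matrix ι ι 𝕜, S'.IsUpperTriangular → U'.IsUpperTriangular → S' ≠ 0 → U' ≠ 0 →
        f S' U' ≤ f S U := by
  have := Fintype.ofFinite ι
  let T := Subalgebra.toSubmodule (blockTriangularSubalgebra 𝕜 𝕜 (id : ι → ι))
  have hne : ∀ {B : T}, B ≠ 0 ↔ (B : Matrix ι ι 𝕜) ≠ 0 := Submodule.coe_eq_zero.not.symm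
  have : ProperSpace T := FiniteDimensional.proper 𝕜 T
  have : Nontrivial T :=
    nontrivial_of_ne ⟨1, blockTriangular_one⟩ 0 (hne.mpr one_ne_zero)
  obtain ⟨⟨S, U⟩, ⟨hS, hU⟩, hmax⟩ := exists_isMaxOn_of_smul_invariant
    (h := fun p : T × T => f p.1 p.2)
    (hcont.comp (f := fun p : T × T => ((p.1 : Matrix ι ι 𝕜), (p.2 : Matrix ι ι 𝕜)))
      (by fun_prop) fun p hp => ⟨hne.mp hp.1, hne.mp hp.2⟩)
    fun a b ha hb S U => hinv a b ha hb S U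
  exact ⟨S, U, S.2, U.2, hne.mp hS, hne.mp hU, fun S' U' hS' hU' hS0 hU0 =>
    isMaxOn_iff.mp hmax (⟨S', hS'⟩, ⟨U', hU'⟩) ⟨hne.mpr hS0, hne.mpr hU0⟩⟩

end HomogeneousMaximum

section FirstOrder

theorem eq_zero_of_forall_re_mul_add_nonneg {𝕜 : Type*} [RCLike 𝕜] {m : 𝕜} {d : ℝ}
    (h : ∀ z : 𝕜, 0 ≤ 2 * RCLike.re (z * m) + ‖z‖ ^ 2 * d) : m = 0 := by
  have hd : 0 < |d| + 1 := by positivity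
  have hz := h (((-(|d| + 1)⁻¹ : ℝ) : 𝕜) * star m)
  rw [mul_assoc, RCLike.re_ofReal_mul, RCLike.star_def, RCLike.conj_mul, ← RCLike.ofReal_pow,
    RCLike.ofReal_re, norm_mul, RCLike.norm_ofReal, RCLike.norm_conj, mul_pow, sq_abs] at hz
  have hle : d * (|d| + 1)⁻¹ ≤ 1 := by
    rw [← div_eq_mul_inv, div_le_one hd]
    linarith [le_abs_self d]
  have hprod : 0 ≤ (|d| + 1)⁻¹ * ‖m‖ ^ 2 := by positivity
  have : (|d| + 1)⁻¹ * ‖m‖ ^ 2 = 0 := by nlinarith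
  simpa [hd.ne'] using this

variable {ι : Type*} [Fintype ι]

theorem eq_mul_sum_of_forall_geomMean_mul_sum_le {w m : ι → ℝ} (hw : ∀ i, 0 < w i)
    (hw1 : ∑ i, w i = 1) (hm : ∀ i, 0 < m i)
    (h : ∀ x : ι → ℝ, (∀ i, 0 < x i) → (∏ i, x i ^ w i) * ∑ i, m i ≤ ∑ i, x i * m i) (i : ι) :
    m i = w i * ∑ j, m j := by
  have hz : ∀ i, 0 < m i / w i := fun i => div_pos (hm i) (hw i)
  have hprod : 0 < ∏ i, (m i / w i) ^ w i :=
    Finset.prod_pos fun i _ => Real.rpow_pos_of_pos (hz i) _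
  have harith : ∑ i, w i * (m i / w i) = ∑ i, m i :=
    Finset.sum_congr rfl fun i _ => mul_div_cancel₀ _ (hw i).ne'
  have hle := Real.geom_mean_le_arith_mean_weighted Finset.univ w (fun i => m i / w i)
    (fun i _ => (hw i).le) hw1 fun i _ => (hz i).le
  have hge : ∑ i, w i * (m i / w i) ≤ ∏ i, (m i / w i) ^ w i := by
    have hx := h (fun i => (m i / w i)⁻¹) fun i => inv_pos.mpr (hz i)
    have hsum : ∑ i, (m i / w i)⁻¹ * m i = 1 := by
      rw [← hw1]
      exact Finset.sum_congr rfl fun i _ => by rw [inv_div, div_mul_cancel₀ _ (hm i).ne']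
    simp only [Real.inv_rpow (hz _).le, Finset.prod_inv_distrib, hsum] at hx
    rwa [inv_mul_le_iff₀ hprod, mul_one, ← harith] at hx
  have heq := (Real.geom_mean_eq_arith_mean_weighted_iff_of_pos' Finset.univ w
    (fun i => m i / w i) (fun i _ => hw i) hw1 fun i _ => (hz i).le).mp (hle.antisymm hge) i
    (Finset.mem_univ i)
  rwa [harith, div_eq_iff (hw i).ne', mul_comm] at heq

end FirstOrder

section DiagGeomMean

variable {ι 𝕜 : Type*} [Fintype ι] [NormedField 𝕜]

/-- The weighted geometric mean of the moduli of the diagonal entries of `B`, with weights `w`. -/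
noncomputable def diagGeomMean (w : ι → ℝ) (B : Matrix ι ι 𝕜) : ℝ :=
  ∏ i, ‖B i i‖ ^ w i

theorem continuous_diagGeomMean {w : ι → ℝ} (hw : ∀ i, 0 ≤ w i) :
    Continuous (diagGeomMean w : Matrix ι ι 𝕜 → ℝ) :=
  continuous_finsetProd _ fun i _ => Continuous.rpow_const (by fun_prop) fun _ => Or.inr (hw i)

theorem diagGeomMean_one [DecidableEq ι] (w : ι → ℝ) : diagGeomMean w (1 : Matrix ι ι 𝕜) = 1 := by
  simp [diagGeomMean]

theorem diagGeomMean_zero {w : ι → ℝ} {i : ι} (hi : w i ≠ 0) :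
    diagGeomMean w (0 : Matrix ι ι 𝕜) = 0 :=
  Finset.prod_eq_zero (Finset.mem_univ i) (by simp [hi])

theorem diagGeomMean_smul {w : ι → ℝ} (hw : ∀ i, 0 ≤ w i) (hw1 : ∑ i, w i = 1)
    {R : Type*} [NormedField R] [NormedSpace R 𝕜] (c : R) (B : Matrix ι ι 𝕜) :
    diagGeomMean w (c • B) = ‖c‖ * diagGeomMean w B := by
  calc diagGeomMean w (c • B) = ∏ i, ‖c‖ ^ w i * ‖B i i‖ ^ w i :=
        Finset.prod_congr rfl fun i _ => by
          rw [Matrix.smul_apply, norm_smul, Real.mul_rpow (norm_nonneg _) (norm_nonneg _)]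
    _ = ‖c‖ * diagGeomMean w B := by
        rw [Finset.prod_mul_distrib, ← Real.rpow_sum_of_nonneg (norm_nonneg c) fun i _ => hw i, hw1,
          Real.rpow_one, diagGeomMean]

variable [LinearOrder ι]

theorem mul_apply_self_of_isUpperTriangular {R : Type*} [NonUnitalNonAssocSemiring R]
    {B C : Matrix ι ι R} (hB : B.IsUpperTriangular) (hC : C.IsUpperTriangular) (i : ι) :
    (B * C) i i = B i i * C i i := by
  rw [mul_apply]
  refine Finset.sum_eq_single i (fun j _ hji => ?_) (by simp)
  rcases lt_or_gt_of_ne hji with hlt | hgt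
  · rw [hB hlt, zero_mul]
  · rw [hC hgt, mul_zero]

theorem diagGeomMean_mul (w : ι → ℝ) {B C : Matrix ι ι 𝕜} (hB : B.IsUpperTriangular)
    (hC : C.IsUpperTriangular) :
    diagGeomMean w (B * C) = diagGeomMean w B * diagGeomMean w C := by
  simp only [diagGeomMean, mul_apply_self_of_isUpperTriangular hB hC, norm_mul,
    Real.mul_rpow (norm_nonneg _) (norm_nonneg _), Finset.prod_mul_distrib]

theorem isUnit_of_diagGeomMean_ne_zero {w : ι → ℝ} (hw : ∀ i, w i ≠ 0) {B : Matrix ι ι 𝕜}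
    (hB : B.IsUpperTriangular) (h : diagGeomMean w B ≠ 0) : IsUnit B := by
  rw [isUnit_iff_isUnit_det, det_of_isUpperTriangular hB, isUnit_iff_ne_zero,
    Finset.prod_ne_zero_iff]
  intro i hi hii
  exact h (Finset.prod_eq_zero hi (by simp [hii, hw i]))

end DiagGeomMean

section Stationarity

variable {ι 𝕜 : Type*} [Fintype ι] [LinearOrder ι] [RCLike 𝕜] {w : ι → ℝ} {M : Matrix ι ι 𝕜}

theorem re_trace_one_add_single_mul_mul_conjTranspose {ι : Type*} [Fintype ι] [DecidableEq ι]
    {M : Matrix ι ι 𝕜} (hM : M.IsHermitian) (i j : ι) (z : 𝕜) :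
    RCLike.re ((1 + single i j z) * M * (1 + single i j z)ᴴ).trace =
      RCLike.re M.trace + (2 * RCLike.re (z * M j i) + ‖z‖ ^ 2 * RCLike.re (M j j)) := by
  have htrace : ((1 + single i j z) * M * (1 + single i j z)ᴴ).trace =
      M.trace + z * M j i + star (z * M j i) + ((‖z‖ ^ 2 : ℝ) : 𝕜) * M j j := by
    rw [RCLike.ofReal_pow, ← RCLike.mul_conj, conjTranspose_add, conjTranspose_one,
      conjTranspose_single, add_mul, mul_add, one_mul, mul_one, add_mul, trace_add, trace_add,
      trace_add, trace_single_mul, trace_mul_single, single_mul_mul_single, trace_single_eq_same,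
      ← hM.apply i j, star_mul', op_smul_eq_mul, RCLike.star_def]
    simp only [smul_eq_mul]
    ring
  simp only [htrace, map_add, RCLike.star_def, RCLike.conj_re, RCLike.re_ofReal_mul]
  ring

theorem apply_eq_zero_of_forall_diagGeomMean_sq_mul_le (hM : M.IsHermitian)
    (h : ∀ B : Matrix ι ι 𝕜, B.IsUpperTriangular →
      diagGeomMean w B ^ 2 * RCLike.re M.trace ≤ RCLike.re (B * M * Bᴴ).trace)
    {i j : ι} (hij : i < j) : M j i = 0 := by
  refine eq_zero_of_forall_re_mul_add_nonneg (d := RCLike.re (M j j)) fun z => ?_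
  have hB : (1 + single i j z).IsUpperTriangular :=
    blockTriangular_one.add (blockTriangular_single hij.le z)
  have hmean : diagGeomMean w (1 + single i j z) = 1 := by
    have hdiag : ∀ l, single i j z l l = 0 := fun l =>
      single_apply_of_ne _ _ _ _ _ fun hl => hij.ne (hl.1.trans hl.2.symm)
    simp [diagGeomMean, hdiag]
  have hle := h _ hB
  rw [hmean, one_pow, one_mul, re_trace_one_add_single_mul_mul_conjTranspose hM] at hle
  exact nonneg_of_le_add_right hle

theorem re_apply_self_eq_of_forall_diagGeomMean_sq_mul_le (hw : ∀ i, 0 < w i)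
    (hw1 : ∑ i, w i = 1) (hM : M.PosDef)
    (h : ∀ B : Matrix ι ι 𝕜, B.IsUpperTriangular →
      diagGeomMean w B ^ 2 * RCLike.re M.trace ≤ RCLike.re (B * M * Bᴴ).trace) (i : ι) :
    RCLike.re (M i i) = w i * RCLike.re M.trace := by
  have htrace : RCLike.re M.trace = ∑ i, RCLike.re (M i i) := map_sum _ _ _
  rw [htrace]
  refine eq_mul_sum_of_forall_geomMean_mul_sum_le (m := fun i => RCLike.re (M i i)) hw hw1
    (fun i => (RCLike.pos_iff.mp hM.diag_pos).1) (fun x hx => ?_) i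
  have hmean : diagGeomMean w (diagonal fun i => ((√(x i) : ℝ) : 𝕜)) ^ 2 = ∏ i, x i ^ w i := by
    rw [diagGeomMean, ← Finset.prod_pow]
    refine Finset.prod_congr rfl fun i _ => ?_
    rw [diagonal_apply_eq, RCLike.norm_ofReal, abs_of_nonneg (Real.sqrt_nonneg _),
      Real.rpow_pow_comm (Real.sqrt_nonneg _), Real.sq_sqrt (hx i).le]
  have htr : RCLike.re (diagonal (fun i => ((√(x i) : ℝ) : 𝕜)) * M *
      (diagonal fun i => ((√(x i) : ℝ) : 𝕜))ᴴ).trace = ∑ i, x i * RCLike.re (M i i) := by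
    rw [trace, map_sum]
    refine Finset.sum_congr rfl fun i _ => ?_
    rw [diag_apply, diagonal_conjTranspose, mul_diagonal, diagonal_mul, Pi.star_apply,
      RCLike.star_def, RCLike.conj_ofReal, mul_comm, ← mul_assoc, ← RCLike.ofReal_mul,
      Real.mul_self_sqrt (hx i).le, RCLike.re_ofReal_mul]
  rw [← hmean, ← htr, ← htrace]
  exact h _ (blockTriangular_diagonal _)

theorem eq_smul_diagonal_of_forall_diagGeomMean_sq_mul_le (hw : ∀ i, 0 < w i)
    (hw1 : ∑ i, w i = 1) (hM : M.PosDef)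
    (h : ∀ B : Matrix ι ι 𝕜, B.IsUpperTriangular →
      diagGeomMean w B ^ 2 * RCLike.re M.trace ≤ RCLike.re (B * M * Bᴴ).trace) :
    M = RCLike.re M.trace • diagonal fun i => (w i : 𝕜) := by
  have hlower : ∀ {i j : ι}, i < j → M j i = 0 :=
    apply_eq_zero_of_forall_diagGeomMean_sq_mul_le hM.isHermitian h
  ext i j
  rw [Matrix.smul_apply]
  rcases lt_trichotomy i j with hij | rfl | hij
  · rw [diagonal_apply_ne _ hij.ne, smul_zero, ← hM.isHermitian.apply, hlower hij, star_zero]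
  · rw [diagonal_apply_eq, RCLike.real_smul_ofReal, mul_comm, ← RCLike.ofReal_mul,
      ← re_apply_self_eq_of_forall_diagGeomMean_sq_mul_le hw hw1 hM h i,
      hM.isHermitian.coe_re_apply_self]
  · rw [diagonal_apply_ne _ hij.ne', smul_zero, hlower hij]

theorem conj_eq_smul_diagonal_of_forall_diagGeomMean_sq_mul_le
    (hw : ∀ i, 0 < w i) (hw1 : ∑ i, w i = 1) {H S : Matrix ι ι 𝕜} (hH : H.PosDef)
    (hS : S.IsUpperTriangular) (hS0 : diagGeomMean w S ≠ 0)
    (h : ∀ S' : Matrix ι ι 𝕜, S'.IsUpperTriangular →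
      diagGeomMean w S' ^ 2 * RCLike.re (S * H * Sᴴ).trace ≤
        diagGeomMean w S ^ 2 * RCLike.re (S' * H * S'ᴴ).trace) :
    S * H * Sᴴ = RCLike.re (S * H * Sᴴ).trace • diagonal fun i => (w i : 𝕜) := by
  have hSu : IsUnit S := isUnit_of_diagGeomMean_ne_zero (fun i => (hw i).ne') hS hS0
  have hM : (S * H * Sᴴ).PosDef := (IsUnit.posDef_star_right_conjugate_iff hSu).mpr hH
  refine eq_smul_diagonal_of_forall_diagGeomMean_sq_mul_le hw hw1 hM fun B hB => ?_
  have hassoc : B * S * H * (B * S)ᴴ = B * (S * H * Sᴴ) * Bᴴ := by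
    simp only [conjTranspose_mul, Matrix.mul_assoc]
  have hBS := h (B * S) (hB.mul hS)
  rw [diagGeomMean_mul w hB hS, mul_pow, mul_comm (diagGeomMean w B ^ 2), mul_assoc,
    hassoc] at hBS
  exact le_of_mul_le_mul_left hBS (by positivity)

end Stationarity

section PositiveDefinite

variable {ι 𝕜 : Type*} [Fintype ι] [DecidableEq ι] [RCLike 𝕜]

theorem conjTranspose_cfcSqrt (ρ : Matrix ι ι 𝕜) : (CFC.sqrt ρ)ᴴ = CFC.sqrt ρ :=
  (nonneg_iff_posSemidef.mp (CFC.sqrt_nonneg ρ)).isHermitian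

theorem cfcSqrt_mul_cfcSqrt {ρ : Matrix ι ι 𝕜} (hρ : ρ.PosSemidef) :
    CFC.sqrt ρ * CFC.sqrt ρ = ρ :=
  CFC.sqrt_mul_sqrt_self ρ (nonneg_iff_posSemidef.mpr hρ)

theorem isUnit_cfcSqrt {ρ : Matrix ι ι 𝕜} (hρ : ρ.PosDef) : IsUnit (CFC.sqrt ρ) :=
  CFC.isUnit_sqrt_iff ρ (nonneg_iff_posSemidef.mpr hρ.posSemidef) |>.mpr hρ.isUnit

theorem posDef_conjTranspose_mul_self_iff_isUnit {B : Matrix ι ι 𝕜} :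
    (Bᴴ * B).PosDef ↔ IsUnit B :=
  ⟨fun h => isUnit_of_mul_isUnit_right h.isUnit, fun h =>
    PosDef.conjTranspose_mul_self B (mulVec_injective_iff_isUnit.mpr h)⟩

/-- The matrix `√ρ (χ*)⁻¹`, a congruence carrying `χ* χ` to `ρ`. The scaling matrices of the
theorem are `S = rootCongruence ρ₀ χ₀` and `T = (rootCongruence ρT χT)⁻¹`. -/
noncomputable def rootCongruence (ρ χ : Matrix ι ι 𝕜) : Matrix ι ι 𝕜 :=
  CFC.sqrt ρ * (χᴴ)⁻¹

variable {ρ χ : Matrix ι ι 𝕜}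

theorem conjTranspose_rootCongruence (ρ χ : Matrix ι ι 𝕜) :
    (rootCongruence ρ χ)ᴴ = χ⁻¹ * CFC.sqrt ρ := by
  rw [rootCongruence, conjTranspose_mul, conjTranspose_cfcSqrt, conjTranspose_nonsing_inv,
    conjTranspose_conjTranspose]

theorem isUnit_rootCongruence (hρ : ρ.PosDef) (hχ : IsUnit χ) : IsUnit (rootCongruence ρ χ) :=
  (isUnit_cfcSqrt hρ).mul (isUnit_nonsing_inv_iff.mpr hχ.star)

theorem inv_rootCongruence (hχ : IsUnit χ) :
    (rootCongruence ρ χ)⁻¹ = χᴴ * (CFC.sqrt ρ)⁻¹ := by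
  have hdet : IsUnit χᴴ.det := (isUnit_iff_isUnit_det _).mp hχ.star
  rw [rootCongruence, Matrix.mul_inv_rev, nonsing_inv_nonsing_inv _ hdet]

theorem rootCongruence_mul_mul_conjTranspose (hρ : ρ.PosSemidef) (hχ : IsUnit χ) :
    rootCongruence ρ χ * (χᴴ * χ) * (rootCongruence ρ χ)ᴴ = ρ := by
  have hdet : IsUnit χ.det := (isUnit_iff_isUnit_det _).mp hχ
  have hdetH : IsUnit χᴴ.det := (isUnit_iff_isUnit_det _).mp hχ.star
  calc rootCongruence ρ χ * (χᴴ * χ) * (rootCongruence ρ χ)ᴴ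
      = CFC.sqrt ρ * ((χᴴ)⁻¹ * χᴴ) * (χ * χ⁻¹) * CFC.sqrt ρ := by
        rw [conjTranspose_rootCongruence, rootCongruence]
        simp only [Matrix.mul_assoc]
    _ = ρ := by
        rw [nonsing_inv_mul _ hdetH, mul_nonsing_inv _ hdet, Matrix.mul_one, Matrix.mul_one,
          cfcSqrt_mul_cfcSqrt hρ]

theorem conjTranspose_rootCongruence_mul_self (hρ : ρ.PosSemidef) (hχ : IsUnit χ)
    {φ : Matrix ι ι 𝕜} (h : ρ = χ * φ * χᴴ) :
    (rootCongruence ρ χ)ᴴ * rootCongruence ρ χ = φ := by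
  have hdet : IsUnit χ.det := (isUnit_iff_isUnit_det _).mp hχ
  have hdetH : IsUnit χᴴ.det := (isUnit_iff_isUnit_det _).mp hχ.star
  calc (rootCongruence ρ χ)ᴴ * rootCongruence ρ χ
      = χ⁻¹ * (CFC.sqrt ρ * CFC.sqrt ρ) * (χᴴ)⁻¹ := by
        rw [conjTranspose_rootCongruence, rootCongruence]
        simp only [Matrix.mul_assoc]
    _ = (χ⁻¹ * χ) * φ * (χᴴ * (χᴴ)⁻¹) := by
        rw [cfcSqrt_mul_cfcSqrt hρ, h]
        simp only [Matrix.mul_assoc]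
    _ = φ := by
        rw [nonsing_inv_mul _ hdet, mul_nonsing_inv _ hdetH, Matrix.one_mul, Matrix.mul_one]

end PositiveDefinite

theorem trace_mul_pos {ι 𝕜 : Type*} [Fintype ι] [RCLike 𝕜] {P X : Matrix ι ι 𝕜}
    (hP : P.PosDef) (hX : X.PosSemidef) (hX0 : X ≠ 0) :
    0 < (P * X).trace := by
  classical
  have hconj := hX.mul_mul_conjTranspose_same (CFC.sqrt P)
  have htrace : (CFC.sqrt P * X * (CFC.sqrt P)ᴴ).trace = (P * X).trace := by
    rw [conjTranspose_cfcSqrt, trace_mul_cycle, cfcSqrt_mul_cfcSqrt hP.posSemidef]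
  rw [← htrace]
  refine hconj.trace_nonneg.lt_of_ne' fun h0 => hX0 ?_
  have hu := isUnit_cfcSqrt hP
  rwa [hconj.trace_eq_zero_iff, conjTranspose_cfcSqrt, hu.mul_left_eq_zero,
    hu.mul_right_eq_zero] at h0

section Kraus

variable {n k : ℕ} {A : Fin k → Matrix (Fin n) (Fin n) ℂ}

theorem IsPositive.posDef_apply {Q : Matrix (Fin n) (Fin n) ℂ →ₗ[ℂ] Matrix (Fin n) (Fin n) ℂ}
    (hQ : IsPositive Q) {X : Matrix (Fin n) (Fin n) ℂ} (hX : X.PosSemidef) (hX0 : X ≠ 0) :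
    (Q X).PosDef := by
  have htrace : 0 < X.trace :=
    hX.trace_nonneg.lt_of_ne' fun h => hX0 (hX.trace_eq_zero_iff.mp h)
  have hnormalized : (Q (X.trace⁻¹ • X)).PosDef :=
    hQ _ (hX.smul (inv_pos.mpr htrace).le) (by
      rw [trace_smul, smul_eq_mul, inv_mul_cancel₀ htrace.ne'])
  simpa only [map_smul, smul_inv_smul₀ htrace.ne'] using hnormalized.smul htrace

theorem IsPositive.posDef_apply_of_posDef
    {Q : Matrix (Fin n) (Fin n) ℂ →ₗ[ℂ] Matrix (Fin n) (Fin n) ℂ} (hQ : IsPositive Q)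
    {X : Matrix (Fin n) (Fin n) ℂ} (hX : X.PosDef) : (Q X).PosDef := by
  rcases isEmpty_or_nonempty (Fin n) with _ | _
  · rwa [Subsingleton.elim (Q X) X]
  · exact hQ.posDef_apply hX.posSemidef hX.isUnit.ne_zero

theorem isHermitian_krausDual (A : Fin k → Matrix (Fin n) (Fin n) ℂ)
    {Y : Matrix (Fin n) (Fin n) ℂ} (hY : Y.IsHermitian) : (krausDual A Y).IsHermitian := by
  simp [IsHermitian, krausDual, conjTranspose_sum, Matrix.mul_assoc, hY.eq]

theorem trace_krausMap_mul_of_isHermitian (A : Fin k → Matrix (Fin n) (Fin n) ℂ)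
    (X : Matrix (Fin n) (Fin n) ℂ) {Y : Matrix (Fin n) (Fin n) ℂ} (hY : Y.IsHermitian) :
    (krausMap A X * Y).trace = (X * krausDual A Y).trace := by
  simpa only [hY.eq, (isHermitian_krausDual A hY).eq] using trace_krausMap_mul A X Y

theorem isPositive_krausDual (hA : IsPositive (krausMap A)) : IsPositive (krausDual A) := by
  intro Y hY hY1
  have hY0 : Y ≠ 0 := by
    rintro rfl
    simp at hY1
  refine PosDef.of_dotProduct_mulVec_pos (isHermitian_krausDual A hY.isHermitian) fun v hv => ?_
  have hQ : (krausMap A (vecMulVec v (star v))).PosDef :=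
    hA.posDef_apply (posSemidef_vecMulVec_self_star v) (by simp [vecMulVec_eq_zero, hv])
  calc 0 < (krausMap A (vecMulVec v (star v)) * Y).trace := trace_mul_pos hQ hY hY0
    _ = (vecMulVec v (star v) * krausDual A Y).trace :=
        trace_krausMap_mul_of_isHermitian A _ hY.isHermitian
    _ = star v ⬝ᵥ (krausDual A Y *ᵥ v) := by
        rw [vecMulVec_mul, trace_vecMulVec, dotProduct_comm, dotProduct_mulVec]

/-- The trace of `S Q(U* U) S*` for `Q = krausMap A`; it also equals the trace of
`U Q'(S* S) U*`, which makes the optimization problem symmetric in `S` and `U`. -/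
noncomputable def krausEnergy (A : Fin k → Matrix (Fin n) (Fin n) ℂ)
    (S U : Matrix (Fin n) (Fin n) ℂ) : ℝ :=
  (S * krausMap A (Uᴴ * U) * Sᴴ).trace.re

theorem krausEnergy_eq_re_trace_krausDual (A : Fin k → Matrix (Fin n) (Fin n) ℂ)
    (S U : Matrix (Fin n) (Fin n) ℂ) :
    krausEnergy A S U = (U * krausDual A (Sᴴ * S) * Uᴴ).trace.re := by
  rw [krausEnergy, trace_mul_cycle, trace_mul_comm, trace_krausMap_mul_of_isHermitian _ _
    (isHermitian_conjTranspose_mul_self S), trace_mul_cycle U]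

theorem krausEnergy_pos (hA : IsPositive (krausMap A)) {S U : Matrix (Fin n) (Fin n) ℂ}
    (hS : S ≠ 0) (hU : U ≠ 0) : 0 < krausEnergy A S U := by
  have hQ : (krausMap A (Uᴴ * U)).PosDef :=
    hA.posDef_apply (posSemidef_conjTranspose_mul_self U) (by simpa using hU)
  rw [krausEnergy, trace_mul_cycle, trace_mul_comm]
  exact (Complex.pos_iff.mp (trace_mul_pos hQ (posSemidef_conjTranspose_mul_self S)
    (by simpa using hS))).1

theorem krausEnergy_smul_smul (A : Fin k → Matrix (Fin n) (Fin n) ℂ) (a b : ℝ)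
    (S U : Matrix (Fin n) (Fin n) ℂ) :
    krausEnergy A (a • S) (b • U) = (a * b) ^ 2 * krausEnergy A S U := by
  simp only [krausEnergy, conjTranspose_smul, star_trivial, Matrix.smul_mul, Matrix.mul_smul,
    LinearMap.map_smul_of_tower, smul_smul, trace_smul, Complex.smul_re, smul_eq_mul]
  ring

theorem continuous_krausEnergy (A : Fin k → Matrix (Fin n) (Fin n) ℂ) :
    Continuous fun p : Matrix (Fin n) (Fin n) ℂ × Matrix (Fin n) (Fin n) ℂ =>
      krausEnergy A p.1 p.2 := by
  simp only [krausEnergy, krausMap, LinearMap.coe_mk, AddHom.coe_mk]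
  fun_prop

theorem exists_isUpperTriangular_maximizer [NeZero n] (hA : IsPositive (krausMap A))
    {w v : Fin n → ℝ} (hw : ∀ i, 0 < w i) (hw1 : ∑ i, w i = 1) (hv : ∀ i, 0 < v i)
    (hv1 : ∑ i, v i = 1) :
    ∃ S U : Matrix (Fin n) (Fin n) ℂ, S.IsUpperTriangular ∧ U.IsUpperTriangular ∧
      diagGeomMean w S ≠ 0 ∧ diagGeomMean v U ≠ 0 ∧
      ∀ S' U' : Matrix (Fin n) (Fin n) ℂ, S'.IsUpperTriangular → U'.IsUpperTriangular →
        (diagGeomMean w S' * diagGeomMean v U') ^ 2 * krausEnergy A S U ≤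
          (diagGeomMean w S * diagGeomMean v U) ^ 2 * krausEnergy A S' U' := by
  have hcont : ContinuousOn (fun p : Matrix (Fin n) (Fin n) ℂ × Matrix (Fin n) (Fin n) ℂ =>
      (diagGeomMean w p.1 * diagGeomMean v p.2) ^ 2 / krausEnergy A p.1 p.2)
      ({0}ᶜ ×ˢ {0}ᶜ) := by
    have hmeanS := continuous_diagGeomMean (𝕜 := ℂ) fun i => (hw i).le
    have hmeanU := continuous_diagGeomMean (𝕜 := ℂ) fun i => (hv i).le
    exact ContinuousOn.div (by fun_prop) (continuous_krausEnergy A).continuousOn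
      fun p hp => (krausEnergy_pos hA hp.1 hp.2).ne'
  have hinv : ∀ a b : ℝ, 0 < a → 0 < b → ∀ S U : Matrix (Fin n) (Fin n) ℂ,
      (diagGeomMean w (a • S) * diagGeomMean v (b • U)) ^ 2 / krausEnergy A (a • S) (b • U) =
        (diagGeomMean w S * diagGeomMean v U) ^ 2 / krausEnergy A S U := by
    intro a b ha hb S U
    rw [krausEnergy_smul_smul, diagGeomMean_smul (fun i => (hw i).le) hw1,
      diagGeomMean_smul (fun i => (hv i).le) hv1, Real.norm_of_nonneg ha.le,
      Real.norm_of_nonneg hb.le, mul_mul_mul_comm a, mul_pow (a * b)]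
    exact mul_div_mul_left _ _ (by positivity)
  obtain ⟨S, U, hS, hU, hS0, hU0, hmax⟩ :=
    exists_isUpperTriangular_forall_le_of_smul_invariant
      (f := fun S U => (diagGeomMean w S * diagGeomMean v U) ^ 2 / krausEnergy A S U) hcont hinv
  have hSU : 0 < krausEnergy A S U := krausEnergy_pos hA hS0 hU0
  have hratio : 0 < (diagGeomMean w S * diagGeomMean v U) ^ 2 / krausEnergy A S U := by
    have hle := hmax 1 1 blockTriangular_one blockTriangular_one one_ne_zero one_ne_zero
    have hone : 0 < krausEnergy A 1 1 := krausEnergy_pos hA one_ne_zero one_ne_zero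
    refine lt_of_lt_of_le ?_ hle
    rw [diagGeomMean_one, diagGeomMean_one]
    positivity
  obtain ⟨hmeanS, hmeanU⟩ : diagGeomMean w S ≠ 0 ∧ diagGeomMean v U ≠ 0 := by
    rw [← mul_ne_zero_iff, ← pow_ne_zero_iff two_ne_zero]
    exact (div_ne_zero_iff.mp hratio.ne').1
  refine ⟨S, U, hS, hU, hmeanS, hmeanU, fun S' U' hS' hU' => ?_⟩
  by_cases hS0' : S' = 0
  · simp [hS0', diagGeomMean_zero (hw 0).ne', krausEnergy]
  by_cases hU0' : U' = 0
  · simp [hU0', diagGeomMean_zero (hv 0).ne', krausEnergy]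
  exact (div_le_div_iff₀ (krausEnergy_pos hA hS0' hU0') hSU).mp (hmax S' U' hS' hU' hS0' hU0')

theorem exists_smul_diagonal_marginals [NeZero n] (hA : IsPositive (krausMap A))
    {w v : Fin n → ℝ} (hw : ∀ i, 0 < w i) (hw1 : ∑ i, w i = 1) (hv : ∀ i, 0 < v i)
    (hv1 : ∑ i, v i = 1) :
    ∃ (c : ℝ) (S U : Matrix (Fin n) (Fin n) ℂ), 0 < c ∧ IsUnit S ∧ IsUnit U ∧
      S * krausMap A (Uᴴ * U) * Sᴴ = c • diagonal (fun i => (w i : ℂ)) ∧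
      U * krausDual A (Sᴴ * S) * Uᴴ = c • diagonal (fun i => (v i : ℂ)) := by
  obtain ⟨S, U, hS, hU, hS0, hU0, hmax⟩ := exists_isUpperTriangular_maximizer hA hw hw1 hv hv1
  have hSu : IsUnit S := isUnit_of_diagGeomMean_ne_zero (fun i => (hw i).ne') hS hS0
  have hUu : IsUnit U := isUnit_of_diagGeomMean_ne_zero (fun i => (hv i).ne') hU hU0
  have hQ : (krausMap A (Uᴴ * U)).PosDef :=
    hA.posDef_apply_of_posDef (posDef_conjTranspose_mul_self_iff_isUnit.mpr hUu)
  have hQ' : (krausDual A (Sᴴ * S)).PosDef :=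
    (isPositive_krausDual hA).posDef_apply_of_posDef
      (posDef_conjTranspose_mul_self_iff_isUnit.mpr hSu)
  refine ⟨krausEnergy A S U, S, U, krausEnergy_pos hA hSu.ne_zero hUu.ne_zero, hSu, hUu, ?_, ?_⟩
  · refine conj_eq_smul_diagonal_of_forall_diagGeomMean_sq_mul_le hw hw1 hQ hS hS0 fun S' hS' => ?_
    have hle := hmax S' U hS' hU
    rw [mul_pow, mul_pow, mul_right_comm, mul_right_comm (diagGeomMean w S ^ 2)] at hle
    exact le_of_mul_le_mul_right hle (by positivity)
  · rw [krausEnergy_eq_re_trace_krausDual]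
    refine conj_eq_smul_diagonal_of_forall_diagGeomMean_sq_mul_le hv hv1 hQ' hU hU0 fun U' hU' => ?_
    have hle := hmax S U' hS hU'
    rw [mul_pow, mul_pow, mul_assoc, mul_assoc, krausEnergy_eq_re_trace_krausDual,
      krausEnergy_eq_re_trace_krausDual] at hle
    exact le_of_mul_le_mul_left hle (by positivity)

theorem exists_diagonal_marginals (hA : IsPositive (krausMap A)) {w v : Fin n → ℝ}
    (hw : ∀ i, 0 < w i) (hv : ∀ i, 0 < v i) (hwv : ∑ i, w i = ∑ i, v i) :
    ∃ S U : Matrix (Fin n) (Fin n) ℂ, IsUnit S ∧ IsUnit U ∧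
      S * krausMap A (Uᴴ * U) * Sᴴ = diagonal (fun i => (w i : ℂ)) ∧
      U * krausDual A (Sᴴ * S) * Uᴴ = diagonal (fun i => (v i : ℂ)) := by
  rcases n.eq_zero_or_pos with rfl | hn
  · exact ⟨1, 1, isUnit_one, isUnit_one, Subsingleton.elim _ _, Subsingleton.elim _ _⟩
  have : NeZero n := ⟨hn.ne'⟩
  set t := ∑ i, w i with ht
  have ht0 : 0 < t := Finset.sum_pos (fun i _ => hw i) Finset.univ_nonempty
  obtain ⟨c, S, U, hc, hS, hU, hSQ, hUQ⟩ := exists_smul_diagonal_marginals hA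
    (w := fun i => w i / t) (v := fun i => v i / t) (fun i => div_pos (hw i) ht0)
    (by rw [← Finset.sum_div, ← ht, div_self ht0.ne']) (fun i => div_pos (hv i) ht0)
    (by rw [← Finset.sum_div, ← hwv, div_self ht0.ne'])
  have hsq : √(t / c) * √(t / c) = t / c := Real.mul_self_sqrt (by positivity)
  have hsqrt : √(t / c) ≠ 0 := by positivity
  have hdiag : ∀ u : Fin n → ℝ, (t / c) • c • diagonal (fun i => ((u i / t : ℝ) : ℂ)) =
      diagonal fun i => (u i : ℂ) := by
    intro u
    rw [smul_smul, div_mul_cancel₀ t hc.ne', ← diagonal_smul]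
    congr 1
    ext i
    simp [mul_div_cancel₀, ht0.ne']
  refine ⟨√(t / c) • S, U, hS.smul (Units.mk0 _ hsqrt), hU, ?_, ?_⟩
  · rw [conjTranspose_smul, star_trivial, Matrix.smul_mul, Matrix.smul_mul, Matrix.mul_smul,
      smul_smul, hsq, hSQ, hdiag]
  · rw [conjTranspose_smul, star_trivial, Matrix.smul_mul, Matrix.mul_smul, smul_smul, hsq,
      LinearMap.map_smul_of_tower, Matrix.mul_smul, Matrix.smul_mul, hUQ, hdiag]

theorem exists_prescribed_marginals (hA : IsPositive (krausMap A))
    {ρ σ : Matrix (Fin n) (Fin n) ℂ} (hρ : ρ.PosDef) (hσ : σ.PosDef) (htrace : ρ.trace = σ.trace) :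
    ∃ S U : Matrix (Fin n) (Fin n) ℂ, IsUnit S ∧ IsUnit U ∧
      S * krausMap A (Uᴴ * U) * Sᴴ = ρ ∧ U * krausDual A (Sᴴ * S) * Uᴴ = σ := by
  have hsum : ∑ i, hρ.1.eigenvalues i = ∑ i, hσ.1.eigenvalues i := by
    rw [hρ.1.trace_eq_sum_eigenvalues, hσ.1.trace_eq_sum_eigenvalues] at htrace
    exact_mod_cast htrace
  obtain ⟨S, U, hS, hU, hSQ, hUQ⟩ :=
    exists_diagonal_marginals hA hρ.eigenvalues_pos hσ.eigenvalues_pos hsum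
  let V : Matrix (Fin n) (Fin n) ℂ := hρ.1.eigenvectorUnitary
  let W : Matrix (Fin n) (Fin n) ℂ := hσ.1.eigenvectorUnitary
  have hV : Vᴴ * V = 1 := Unitary.coe_star_mul_self _
  have hW : Wᴴ * W = 1 := Unitary.coe_star_mul_self _
  have hρV : ρ = V * diagonal (fun i => (hρ.1.eigenvalues i : ℂ)) * Vᴴ := hρ.1.spectral_theorem
  have hσW : σ = W * diagonal (fun i => (hσ.1.eigenvalues i : ℂ)) * Wᴴ := hσ.1.spectral_theorem
  have hgram : ∀ {X Y : Matrix (Fin n) (Fin n) ℂ}, Xᴴ * X = 1 → (X * Y)ᴴ * (X * Y) = Yᴴ * Y := by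
    intro X Y hX
    rw [conjTranspose_mul, Matrix.mul_assoc, ← Matrix.mul_assoc Xᴴ, hX, Matrix.one_mul]
  have hconj : ∀ X Y Z : Matrix (Fin n) (Fin n) ℂ,
      X * Y * Z * (X * Y)ᴴ = X * (Y * Z * Yᴴ) * Xᴴ := fun X Y Z => by
    simp only [conjTranspose_mul, Matrix.mul_assoc]
  refine ⟨V * S, W * U, (IsUnit.of_mul_eq_one_right _ hV).mul hS,
    (IsUnit.of_mul_eq_one_right _ hW).mul hU, ?_, ?_⟩
  · rw [hgram hW, hconj, hSQ, ← hρV]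
  · rw [hgram hV, hconj, hUQ, ← hσW]

variable {ρ₀ ρT φ₀ φT φh₀ φhT χ₀ χT : Matrix (Fin n) (Fin n) ℂ}

theorem exists_georgiouPavon (hA : IsPositive (krausMap A)) (hρ₀ : ρ₀.PosDef) (hρT : ρT.PosDef)
    (htrace : ρ₀.trace = ρT.trace) :
    ∃ φ₀ φT φh₀ φhT χ₀ χT : Matrix (Fin n) (Fin n) ℂ,
      GeorgiouPavon A ρ₀ ρT φ₀ φT φh₀ φhT χ₀ χT := by
  obtain ⟨S, U, hS, hU, hSQ, hUQ⟩ := exists_prescribed_marginals hA hρ₀ hρT htrace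
  have hSS := posDef_conjTranspose_mul_self_iff_isUnit.mpr hS
  have hUU := posDef_conjTranspose_mul_self_iff_isUnit.mpr hU
  exact ⟨krausMap A (Uᴴ * U), Uᴴ * U, Sᴴ * S, krausDual A (Sᴴ * S), rootCongruence ρ₀ S, U,
    { posDef_φ₀ := hA.posDef_apply_of_posDef hUU
      posDef_φT := hUU
      posDef_φh₀ := hSS
      posDef_φhT := (isPositive_krausDual hA).posDef_apply_of_posDef hSS
      map_φT := rfl
      dual_φh₀ := rfl
      ρ₀_eq := (rootCongruence_mul_mul_conjTranspose hρ₀.posSemidef hS).symm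
      ρT_eq := hUQ.symm
      φ₀_eq := (conjTranspose_rootCongruence_mul_self hρ₀.posSemidef hS hSQ.symm).symm
      φT_eq := rfl }⟩

theorem isQuantumChannel_scaling_krausMap {S T : GL (Fin n) ℂ}
    (h : T.1ᴴ * krausDual A (S.1ᴴ * S.1) * T.1 = 1) :
    IsQuantumChannel (scaling (krausMap A) S T) := by
  refine ⟨k, fun i => S.1 * A i * T.1, ?_, ?_⟩
  · ext1 X
    simp [scaling, krausMap, Finset.mul_sum, Finset.sum_mul, Matrix.mul_assoc]
  · rw [← h]
    simp [krausDual, Finset.mul_sum, Finset.sum_mul, Matrix.mul_assoc]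

theorem GeorgiouPavon.isUnit_χ₀ (h : GeorgiouPavon A ρ₀ ρT φ₀ φT φh₀ φhT χ₀ χT) : IsUnit χ₀ :=
  posDef_conjTranspose_mul_self_iff_isUnit.mp (h.φ₀_eq ▸ h.posDef_φ₀)

theorem GeorgiouPavon.isUnit_χT (h : GeorgiouPavon A ρ₀ ρT φ₀ φT φh₀ φhT χ₀ χT) : IsUnit χT :=
  posDef_conjTranspose_mul_self_iff_isUnit.mp (h.φT_eq ▸ h.posDef_φT)

theorem GeorgiouPavon.exists_scaling (h : GeorgiouPavon A ρ₀ ρT φ₀ φT φh₀ φhT χ₀ χT)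
    (hρ₀ : ρ₀.PosDef) (hρT : ρT.PosDef) :
    ∃ S T : GL (Fin n) ℂ, S.1 = CFC.sqrt ρ₀ * (χ₀ᴴ)⁻¹ ∧ T.1 = χTᴴ * (CFC.sqrt ρT)⁻¹ ∧
      IsQuantumChannel (scaling (krausMap A) S T) ∧ scaling (krausMap A) S T ρT = ρ₀ := by
  obtain ⟨S, hS⟩ := isUnit_rootCongruence hρ₀ h.isUnit_χ₀
  obtain ⟨N, hN⟩ := isUnit_rootCongruence hρT h.isUnit_χT
  have hSφ₀ : S.1 * φ₀ * S.1ᴴ = ρ₀ := by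
    rw [hS, h.φ₀_eq, rootCongruence_mul_mul_conjTranspose hρ₀.posSemidef h.isUnit_χ₀]
  have hSS : S.1ᴴ * S.1 = φh₀ := by
    rw [hS, conjTranspose_rootCongruence_mul_self hρ₀.posSemidef h.isUnit_χ₀ h.ρ₀_eq]
  have hNφT : N.1 * φT * N.1ᴴ = ρT := by
    rw [hN, h.φT_eq, rootCongruence_mul_mul_conjTranspose hρT.posSemidef h.isUnit_χT]
  have hNN : N.1ᴴ * N.1 = φhT := by
    rw [hN, conjTranspose_rootCongruence_mul_self hρT.posSemidef h.isUnit_χT h.ρT_eq]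
  have hNinv : N.1 * (N⁻¹).1 = 1 := N.mul_inv
  have hinvN : (N⁻¹).1 * N.1 = 1 := N.inv_mul
  have hNinvH : (N⁻¹).1ᴴ * N.1ᴴ = 1 := by rw [← conjTranspose_mul, hNinv, conjTranspose_one]
  have hinvNH : N.1ᴴ * (N⁻¹).1ᴴ = 1 := by rw [← conjTranspose_mul, hinvN, conjTranspose_one]
  refine ⟨S, N⁻¹, hS, ?_, isQuantumChannel_scaling_krausMap ?_, ?_⟩
  · rw [coe_units_inv, hN, inv_rootCongruence h.isUnit_χT]
  · rw [hSS, h.dual_φh₀, ← hNN]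
    calc (N⁻¹).1ᴴ * (N.1ᴴ * N.1) * (N⁻¹).1 = ((N⁻¹).1ᴴ * N.1ᴴ) * (N.1 * (N⁻¹).1) := by
          simp only [Matrix.mul_assoc]
      _ = 1 := by rw [hNinvH, hNinv, one_mul]
  · have hpull : (N⁻¹).1 * ρT * (N⁻¹).1ᴴ = φT := by
      calc (N⁻¹).1 * ρT * (N⁻¹).1ᴴ = ((N⁻¹).1 * N.1) * φT * (N.1ᴴ * (N⁻¹).1ᴴ) := by
            rw [← hNφT]
            simp only [Matrix.mul_assoc]
        _ = φT := by rw [hinvN, hinvNH, one_mul, mul_one]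
    calc scaling (krausMap A) S N⁻¹ ρT
        = S.1 * krausMap A ((N⁻¹).1 * ρT * (N⁻¹).1ᴴ) * S.1ᴴ := rfl
      _ = ρ₀ := by rw [hpull, h.map_φT, hSφ₀]

end Kraus

end QuantumBridge

theorem mainTheorem3_general {n k : ℕ} (A : Fin k → Matrix (Fin n) (Fin n) ℂ)
    (hpos : QuantumBridge.IsPositive (QuantumBridge.krausMap A))
    (ρ₀ ρT : Matrix (Fin n) (Fin n) ℂ)
    (hρ₀ : ρ₀.PosDef) (hρT : ρT.PosDef) (htrace : ρ₀.trace = ρT.trace) :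
    (∃ φ₀ φT φh₀ φhT χ₀ χT : Matrix (Fin n) (Fin n) ℂ,
      QuantumBridge.GeorgiouPavon A ρ₀ ρT φ₀ φT φh₀ φhT χ₀ χT) ∧
    (∀ φ₀ φT φh₀ φhT χ₀ χT : Matrix (Fin n) (Fin n) ℂ,
      QuantumBridge.GeorgiouPavon A ρ₀ ρT φ₀ φT φh₀ φhT χ₀ χT →
      IsUnit χ₀ ∧ IsUnit χT ∧
      ∃ S T : GL (Fin n) ℂ,
        (S : Matrix (Fin n) (Fin n) ℂ) = CFC.sqrt ρ₀ * (χ₀ᴴ)⁻¹ ∧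
        (T : Matrix (Fin n) (Fin n) ℂ) = χTᴴ * (CFC.sqrt ρT)⁻¹ ∧
        QuantumBridge.IsQuantumChannel
          (QuantumBridge.scaling (QuantumBridge.krausMap A) S T) ∧
        QuantumBridge.scaling (QuantumBridge.krausMap A) S T ρT = ρ₀) :=
  ⟨QuantumBridge.exists_georgiouPavon hpos hρ₀ hρT htrace,
    fun _ _ _ _ _ _ h => ⟨h.isUnit_χ₀, h.isUnit_χT, h.exists_scaling hρ₀ hρT⟩⟩

theorem mainTheorem3 {n k : ℕ} (A : Fin k → Matrix (Fin n) (Fin n) ℂ)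
    (hchannel : QuantumBridge.IsQuantumChannel (QuantumBridge.krausMap A))
    (hpos : QuantumBridge.IsPositive (QuantumBridge.krausMap A))
    (ρ₀ ρT : Matrix (Fin n) (Fin n) ℂ)
    (hρ₀ : ρ₀.PosDef) (hρ₀_trace : ρ₀.trace = 1)
    (hρT : ρT.PosDef) (hρT_trace : ρT.trace = 1) :
    (∃ φ₀ φT φh₀ φhT χ₀ χT : Matrix (Fin n) (Fin n) ℂ,
      QuantumBridge.GeorgiouPavon A ρ₀ ρT φ₀ φT φh₀ φhT χ₀ χT) ∧
    (∀ φ₀ φT φh₀ φhT χ₀ χT : Matrix (Fin n) (Fin n) ℂ,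
      QuantumBridge.GeorgiouPavon A ρ₀ ρT φ₀ φT φh₀ φhT χ₀ χT →
      IsUnit χ₀ ∧ IsUnit χT ∧
      ∃ S T : GL (Fin n) ℂ,
        (S : Matrix (Fin n) (Fin n) ℂ) = CFC.sqrt ρ₀ * (χ₀ᴴ)⁻¹ ∧
        (T : Matrix (Fin n) (Fin n) ℂ) = χTᴴ * (CFC.sqrt ρT)⁻¹ ∧
        QuantumBridge.IsQuantumChannel
          (QuantumBridge.scaling (QuantumBridge.krausMap A) S T) ∧
        QuantumBridge.scaling (QuantumBridge.krausMap A) S T ρT = ρ₀) := by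
  exact mainTheorem3_general A hpos ρ₀ ρT hρ₀ hρT (hρ₀_trace.trans hρT_trace.symm)
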